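/- **Theorem 1.** Let $G=(V,E)$ be an infinite, connected, locally finite, vertex-transitive simple graph which is unimodular, i.e. $|A(x,y)|=|A(y,x)|$ for all $x,y\in V$, where $A(x,y)=\{f(y): f\in\operatorname{Aut}(G),\ f(x)=x\}$. *Randomness.* A *path* is a function $y:[0,\infty)\to V$ for which there are $0=t_0<t_1<\dots\to\infty$ and $v_i\in V$ with $y\equiv v_i$ on $[t_i,t_{i+1})$ and $(v_i,v_{i+1})\in E$ for all $i$. Let $\mu$ be a probability distribution on $\mathbb N=\{0,1,\dots\}$, and for each $v\in V$ let $\nu_v$ be a probability distribution on paths starting at $v$ (with the $\sigma$-algebra generated by the evaluations), such that * (invariance) $\gamma\circ y$ has law $\nu_{\gamma v}$ when $y$ has law $\nu_v$, for every $\gamma\in\operatorname{Aut}(G)$ and $v\in V$; * (infinite range) $\nu_v$-a.s. the range of $y$ is infinite. Let $N_v\sim\mu$ (the number of particles starting at $v$), $y^{v,i}\sim\nu_v$ (the putative path of the $i$-th particle starting at $v$) and $U^{v,i}\sim U[0,1]$, for $v\in V$, $i\in\mathbb N$, all be independent. The particles are the pairs $p=(v,i)$ with $i<N_v$. *Interaction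 rule.* The *state at time $t$* consists of the set of particles, together with the mark $U^p$ and the actual path $x^p|_{[0,t]}$ of each particle $p$. An interaction rule gives, for every particle $p$, every $t\ge0$ and every possible state at time $t$, a rate in $[0,\infty)$. Assume that it is automorphism invariant (applying $\gamma\in\operatorname{Aut}(G)$ to the state and to $p$, where $\gamma(v,i)=(\gamma v,i)$, does not change the rate) and local (for some finite $R$, the rate of $p$ at time $t$ depends only on those particles, with their marks and paths up to time $t$, which until time $t$ have come within distance $R$ of the trajectory of $p$). *Model.* The actual path of $p$ is $x^p_t=y^p_{\tau^p(t)}$, where the inner clocks $\tau^p$ satisfy, for all particles $p$ and all $t\ge 0$, $$\tau^p(t)=\int_0^t r^p_s\,ds<\infty ,$$ with $r^p_s$ the rate that the interaction rule gives to $p$ in the state at time $s$. Assume that the model is well defined, unique and local: the clocks $\tau$ are random variables defined on the probability space of $(N,y,U)$; almost surely they solve these equations and every vertex is visited by only finitely many particles in any finite time interval; and almost surely no other family of clocks has these two properties. *Fixation.* A particle is *active* at time $t$ if its rate at time $t$ is positive. A vertex $v$ *fixates* if there is a (minimal) time after which no active particle is at $v$; a particle *fixates* if there is a (minimal) time after which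 it is not active. If every vertex fixates almost surely, then every particle fixates almost surely. -/

import Mathlib

open MeasureTheory Filter
open scoped NNReal unitInterval

noncomputable section

namespace ParticleSystem

universe u

variable {V : Type u}

/-- The graph is transitive: its automorphism group acts transitively on the vertices. -/
def IsTransitive (G : SimpleGraph V) : Prop :=
  ∀ x y : V, ∃ γ : G ≃g G, γ x = y

/-- The orbit of `y` under the stabilizer of `x` in the automorphism group. -/
def stabOrbit (G : SimpleGraph V) (x y : V) : Set V :=
  {z | ∃ γ : G ≃g G, γ x = x ∧ γ y = z}

/-- Unimodularity: `|A(x,y)| = |A(y,x)|` for all vertices. -/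
def IsUnimodular (G : SimpleGraph V) : Prop :=
  ∀ x y : V, (stabOrbit G x y).encard = (stabOrbit G y x).encard

/-- A path in inner time: piecewise constant and right-continuous, with infinitely many jumps
along edges, at times tending to infinity. -/
def IsPath (G : SimpleGraph V) (y : ℝ≥0 → V) : Prop :=
  ∃ (t : ℕ → ℝ≥0) (v : ℕ → V), t 0 = 0 ∧ StrictMono t ∧ Tendsto t atTop atTop ∧
    (∀ i, ∀ s ∈ Set.Ico (t i) (t (i + 1)), y s = v i) ∧ ∀ i, G.Adj (v i) (v (i + 1))

/-- The space of paths. -/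
def Path (G : SimpleGraph V) : Type u := {y : ℝ≥0 → V // IsPath G y}

/-- The `σ`-algebra on the space of paths generated by the evaluations `y ↦ y t`
(every set of vertices being measurable). -/
instance (G : SimpleGraph V) : MeasurableSpace (Path G) :=
  MeasurableSpace.comap (fun y : Path G => y.1) (@MeasurableSpace.pi ℝ≥0 (fun _ => V) fun _ => ⊤)

theorem IsPath.map {G : SimpleGraph V} (γ : G ≃g G) {y : ℝ≥0 → V} (hy : IsPath G y) :
    IsPath G (fun t => γ (y t)) := by
  obtain ⟨t, v, h0, hm, ht, hc, ha⟩ := hy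
  exact ⟨t, fun i => γ (v i), h0, hm, ht, fun i s hs => congrArg γ (hc i s hs),
    fun i => γ.map_rel_iff.2 (ha i)⟩

/-- The image of a path under an automorphism. -/
def Path.map {G : SimpleGraph V} (γ : G ≃g G) (y : Path G) : Path G :=
  ⟨fun t => γ (y.1 t), y.2.map γ⟩

/-- Particle labels: `(v, i)` is the `i`-th particle starting at `v` (with `i = 0, 1, …`);
it exists if `i` is less than the number of particles starting at `v`. -/
abbrev Label (V : Type u) : Type u := V × ℕ

/-- A state of the system at time `t`: for each label, `none` if there is no such particle, and
otherwise the mark in `[0,1]` of the particle and its actual path until time `t`. -/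
def History (V : Type u) (t : ℝ≥0) : Type u := Label V → Option (I × (Set.Iic t → V))

/-- The image of a state under an automorphism: if the particle `(v, i)` has mark `u` and actual
path `x` in `H`, then the particle `(γ v, i)` has mark `u` and actual path `γ ∘ x`. -/
def History.map {G : SimpleGraph V} (γ : G ≃g G) {t : ℝ≥0} (H : History V t) : History V t :=
  fun q => (H (γ.symm q.1, q.2)).map fun a => (a.1, fun s => γ (a.2 s))

/-- The particles `p` and `q` are both present in `H`, and until time `t` the particle `q` has
visited the `R`-neighbourhood of the trajectory of `p`. -/
def History.Near (G : SimpleGraph V) {t : ℝ≥0} (H : History V t) (R : ℕ) (p q : Label V) : Prop :=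
  ∃ a ∈ H p, ∃ b ∈ H q, ∃ s s' : Set.Iic t, G.dist (a.2 s) (b.2 s') ≤ R

/-- An interaction rule: it gives the rate at which the particle `p` progresses along its
putative path at time `t`, as a function of the state of the system at time `t`. -/
def InteractionRule (V : Type u) : Type u := Label V → (t : ℝ≥0) → History V t → ℝ≥0

/-- The interaction rule is automorphism invariant. -/
def InteractionRule.IsInvariant (G : SimpleGraph V) (r : InteractionRule V) : Prop :=
  ∀ (γ : G ≃g G) (p : Label V) (t : ℝ≥0) (H : History V t),
    r (γ p.1, p.2) t (H.map γ) = r p t H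

/-- The interaction rule is local: for some finite radius `R`, the rate of a present particle `p`
depends only on the particles that came within distance `R` of its trajectory. -/
def InteractionRule.IsLocal (G : SimpleGraph V) (r : InteractionRule V) : Prop :=
  ∃ R : ℕ, ∀ (p : Label V) (t : ℝ≥0) (H H' : History V t), (H p).isSome → (H' p).isSome →
    (∀ q, H.Near G R p q ∨ H'.Near G R p q → H q = H' q) → r p t H = r p t H'

/-- The data of a model on `G`: the law `μ` of the number of particles starting at a vertex, the
laws `ν v` of the putative paths of the particles starting at `v`, and the interaction rule. -/
structure Model (G : SimpleGraph V) where
  μ : Measure ℕ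
  ν : V → Measure (Path G)
  rule : InteractionRule V
  probμ : IsProbabilityMeasure μ
  probν : ∀ v, IsProbabilityMeasure (ν v)
  start : ∀ v, ∀ᵐ y ∂(ν v), y.1 0 = v

attribute [instance] Model.probμ Model.probν

/-- The randomness attached to a vertex: the number of particles starting there and, for each
`i`, the putative path and the mark of the `i`-th particle. -/
abbrev Seed (G : SimpleGraph V) : Type u := ℕ × (ℕ → Path G × I)

/-- The sample space. -/
abbrev Sample (G : SimpleGraph V) : Type u := V → Seed G

namespace Model

variable {G : SimpleGraph V} (M : Model G)

/-- The path laws are automorphism invariant: `γ ∘ y` has law `ν (γ v)` if `y` has law `ν v`. In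
particular `ν v` is invariant under the stabilizer of `v`, and, on a transitive graph, it
determines all the other laws. -/
def PathInvariant : Prop :=
  ∀ (γ : G ≃g G) (v : V), (M.ν v).map (Path.map γ) = M.ν (γ v)

/-- A putative path almost surely visits infinitely many vertices. -/
def InfiniteRange : Prop :=
  ∀ v, ∀ᵐ y ∂(M.ν v), (Set.range y.1).Infinite

/-- The law of the randomness: particle numbers with law `μ`, putative paths with laws `ν v` and
uniform marks in `[0,1]`, all independent. -/
def law : Measure (Sample G) :=
  Measure.infinitePi fun v : V =>
    M.μ.prod (Measure.infinitePi fun _ : ℕ => (M.ν v).prod (volume : Measure I))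

end Model

variable {G : SimpleGraph V}

/-- The particle `p` exists. -/
def Present (ω : Sample G) (p : Label V) : Prop := p.2 < (ω p.1).1

/-- The inner clocks: `τ p t` is the inner time of the particle `p` at time `t`. -/
abbrev Clocks (V : Type u) : Type u := Label V → ℝ≥0 → ℝ≥0

/-- The actual path of a particle: its putative path evaluated at its inner clock. -/
def pos (ω : Sample G) (τ : Clocks V) (p : Label V) (t : ℝ≥0) : V :=
  ((ω p.1).2 p.2).1.1 (τ p t)

open Classical in
/-- The state of the system at time `t`. -/
def history (ω : Sample G) (τ : Clocks V) (t : ℝ≥0) : History V t := fun q =>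
  if Present ω q then some (((ω q.1).2 q.2).2, fun s => pos ω τ q s) else none

/-- Every vertex is visited by only finitely many particles in any finite time interval. -/
def LocallyFiniteVisits (ω : Sample G) (τ : Clocks V) : Prop :=
  ∀ (v : V) (t : ℝ≥0), {p : Label V | Present ω p ∧ ∃ s ≤ t, pos ω τ p s = v}.Finite

namespace Model

variable (M : Model G)

/-- The rate of the particle `p` at time `t`. -/
def rate (ω : Sample G) (τ : Clocks V) (p : Label V) (t : ℝ≥0) : ℝ≥0 :=
  M.rule p t (history ω τ t)

/-- The clocks `τ` solve the dynamics for `ω`: every inner clock progresses at the rate given by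
the interaction rule. The clocks of labels without a particle are set to `0` by convention. -/
def IsSolution (ω : Sample G) (τ : Clocks V) : Prop :=
  (∀ p, Present ω p → ∀ t : ℝ≥0,
    IntervalIntegrable (fun s : ℝ => (M.rate ω τ p s.toNNReal : ℝ)) volume 0 t ∧
    (τ p t : ℝ) = ∫ s in (0 : ℝ)..t, (M.rate ω τ p s.toNNReal : ℝ)) ∧
  ∀ p, ¬ Present ω p → ∀ t, τ p t = 0

/-- The model is well defined, unique and local, and `τ` is the resulting random process: `τ` is
measurable, almost surely it solves the dynamics and every vertex is visited by only finitely
many particles in finite time, and almost surely it is the only such solution. -/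
structure IsRealization (τ : Sample G → Clocks V) : Prop where
  aemeasurable : ∀ p t, AEMeasurable (fun ω => τ ω p t) M.law
  solution : ∀ᵐ ω ∂M.law, M.IsSolution ω (τ ω)
  locallyFinite : ∀ᵐ ω ∂M.law, LocallyFiniteVisits ω (τ ω)
  unique : ∀ᵐ ω ∂M.law, ∀ τ₁ : Clocks V,
    M.IsSolution ω τ₁ → LocallyFiniteVisits ω τ₁ → τ₁ = τ ω

/-- The particle `p` exists and is active at time `t`: it moves at a positive rate. -/
def Active (ω : Sample G) (τ : Clocks V) (p : Label V) (t : ℝ≥0) : Prop :=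
  Present ω p ∧ 0 < M.rate ω τ p t

/-- The vertex `v` fixates at time `t`: this is the minimal time after which there are no active
particles at `v`. -/
def VertexFixatesAt (ω : Sample G) (τ : Clocks V) (v : V) (t : ℝ≥0) : Prop :=
  IsLeast {t : ℝ≥0 | ∀ s > t, ∀ p, pos ω τ p s = v → ¬ M.Active ω τ p s} t

/-- The particle `p` fixates at time `t`: this is the minimal time after which it is not
active. -/
def ParticleFixatesAt (ω : Sample G) (τ : Clocks V) (p : Label V) (t : ℝ≥0) : Prop :=
  IsLeast {t : ℝ≥0 | ∀ s > t, ¬ M.Active ω τ p s} t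

/-- Every vertex fixates almost surely. -/
def VertexFixating (τ : Sample G → Clocks V) : Prop :=
  ∀ v : V, ∀ᵐ ω ∂M.law, ∃ t, M.VertexFixatesAt ω (τ ω) v t

/-- Every particle fixates almost surely. -/
def ParticleFixating (τ : Sample G → Clocks V) : Prop :=
  ∀ p : Label V, ∀ᵐ ω ∂M.law, Present ω p → ∃ t, M.ParticleFixatesAt ω (τ ω) p t

end Model

end ParticleSystem

end

/-!
A particle whose inner clock stays bounded visits only finitely many vertices, so it stops being
active once these have fixated (`IsSolution.exists_particleFixatesAt`). It remains to show that
almost surely no inner clock is unbounded.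

A particle with an unbounded clock runs through its whole putative path, and it must leave every
vertex that it visits. Hence it visits each vertex `v` of its putative path before `v` fixates
(`IsSolution.exists_pos_eq_of_vertexFixatesAt`), so that only finitely many particles with
unbounded clocks have `v` on their putative path.

Fix the index `i`, and let each particle `(u, i)` with an unbounded clock spread a unit mass
uniformly over a finite set `S m` of vertices of its putative path, where `S m` increases to the
range of the path as `m` grows. Let `W m` be the mass that a fixed vertex `v` receives.

* By the mass transport principle (`tsum_mass_transport`, which uses unimodularity) the expectation
  of `W m` is the probability that the clock of `(v, i)` is unbounded, for every `m`
  (`lintegral_tsum_indicator_visitMass`). The invariance of the transport comes from that of the law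
  and from the uniqueness of the clocks (`IsRealization.ae_sampleMap`).
* Almost surely `W m` tends to `0`: it is a sum over finitely many particles, and each
  term is at most `1 / |S m|`, which tends to `0` as the range of the path is infinite
  (`tendsto_tsum_indicator_visitMass`).
* `W m` is at most the mass `X m` that `v` would receive if all the particles `(u, i)` spread unit
  masses. This is a sum of independent terms in `[0, 1]` with mean `1` by mass transport, so its
  second moment is at most `2` (`lintegral_tsum_visitMass_sq_le`).

Therefore the `W m` are uniformly integrable, their expectations tend to `0`, and the probability
in question vanishes (`IsRealization.law_unboundedClock`). Only the putative paths need to be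
independent; the dependence between the events that the clocks are unbounded plays no role.
-/

noncomputable section

namespace ParticleSystem

/-! ### The graph: countability and mass transport -/

theorem countable_of_connected {V : Type*} {G : SimpleGraph V} (hconn : G.Connected)
    (hfin : ∀ v, (G.neighborSet v).Finite) : Countable V := by
  obtain ⟨o⟩ := hconn.nonempty
  have hS : ∀ n : ℕ, {v | ∃ p : G.Walk v o, p.length = n}.Countable := by
    intro n
    induction n with
    | zero =>
      refine (Set.countable_singleton o).mono ?_
      rintro v ⟨p, hp⟩
      exact SimpleGraph.Walk.eq_of_length_eq_zero hp
    | succ n ih =>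
      refine (ih.biUnion fun w _ => (hfin w).countable).mono ?_
      rintro v ⟨p, hp⟩
      cases p with
      | nil => simp at hp
      | @cons _ w _ h q =>
        exact Set.mem_biUnion (x := w) ⟨q, by simpa using hp⟩ h.symm
  rw [← Set.countable_univ_iff]
  refine (Set.countable_iUnion hS).mono fun v _ => ?_
  obtain ⟨p⟩ := hconn.preconnected v o
  exact Set.mem_iUnion.2 ⟨p.length, p, rfl⟩

/-- The orbits of pairs of vertices under the diagonal action of the automorphism group. -/
def pairOrbit {V : Type*} (G : SimpleGraph V) : Setoid (V × V) where
  r a b := ∃ γ : G ≃g G, γ a.1 = b.1 ∧ γ a.2 = b.2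
  iseqv :=
    { refl := fun _ => ⟨SimpleGraph.Iso.refl, rfl, rfl⟩
      symm := by
        rintro a b ⟨γ, h1, h2⟩
        exact ⟨γ.symm, by rw [← h1]; exact γ.symm_apply_apply _,
          by rw [← h2]; exact γ.symm_apply_apply _⟩
      trans := by
        rintro a b c ⟨γ, h1, h2⟩ ⟨δ, h3, h4⟩
        exact ⟨γ.trans δ, by rw [← h3, ← h1]; rfl, by rw [← h4, ← h2]; rfl⟩ }

theorem encard_stabOrbit_apply {V : Type*} {G : SimpleGraph V} (γ : G ≃g G) (x y : V) :
    (stabOrbit G (γ x) (γ y)).encard = (stabOrbit G x y).encard := by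
  have : stabOrbit G (γ x) (γ y) = γ '' stabOrbit G x y := by
    ext z
    constructor
    · rintro ⟨δ, h1, h2⟩
      refine ⟨γ.symm z, ⟨(γ.trans δ).trans γ.symm, ?_, ?_⟩, γ.apply_symm_apply z⟩
      · change γ.symm (δ (γ x)) = x
        rw [h1]; exact γ.symm_apply_apply x
      · change γ.symm (δ (γ y)) = γ.symm z
        rw [h2]
    · rintro ⟨w, ⟨δ, h1, h2⟩, rfl⟩
      refine ⟨(γ.symm.trans δ).trans γ, ?_, ?_⟩
      · change γ (δ (γ.symm (γ x))) = γ x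
        rw [show γ.symm (γ x) = x from γ.symm_apply_apply x, h1]
      · change γ (δ (γ.symm (γ y))) = γ w
        rw [show γ.symm (γ y) = y from γ.symm_apply_apply y, h2]
  rw [this, γ.injective.encard_image]

/-- Given a vertex `v` and an orbit of pairs, there are as many `u` with `(v, u)` in the orbit as
there are `u` with `(u, v)` in the orbit: for the orbit of `(a, b)` these numbers are `|A(a,b)|`
and `|A(b,a)|`. -/
theorem encard_pairOrbit_fibre {V : Type*} {G : SimpleGraph V} (htrans : IsTransitive G)
    (huni : IsUnimodular G) (v : V) (Q : Quotient (pairOrbit G)) :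
    {u | (Quotient.mk (pairOrbit G) (v, u)) = Q}.encard
      = {u | (Quotient.mk (pairOrbit G) (u, v)) = Q}.encard := by
  obtain ⟨⟨a, b⟩, rfl⟩ := Quotient.exists_rep Q
  obtain ⟨γ, rfl⟩ := htrans a v
  obtain ⟨δ, hδ⟩ := htrans b (γ a)
  have h1 : {u | (Quotient.mk (pairOrbit G) (γ a, u)) = Quotient.mk (pairOrbit G) (a, b)}
      = stabOrbit G (γ a) (γ b) := by
    ext u
    rw [Set.mem_ofPred_eq, eq_comm, Quotient.eq]
    constructor
    · rintro ⟨ε, e1, e2⟩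
      refine ⟨γ.symm.trans ε, ?_, ?_⟩
      · change ε (γ.symm (γ a)) = γ a
        rw [show γ.symm (γ a) = a from γ.symm_apply_apply a]; exact e1
      · change ε (γ.symm (γ b)) = u
        rw [show γ.symm (γ b) = b from γ.symm_apply_apply b]; exact e2
    · rintro ⟨ε, e1, e2⟩
      exact ⟨γ.trans ε, e1, e2⟩
  have h2 : {u | (Quotient.mk (pairOrbit G) (u, γ a)) = Quotient.mk (pairOrbit G) (a, b)}
      = stabOrbit G (δ b) (δ a) := by
    ext u
    rw [Set.mem_ofPred_eq, eq_comm, Quotient.eq]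
    constructor
    · rintro ⟨ε, e1, e2⟩
      refine ⟨δ.symm.trans ε, ?_, ?_⟩
      · change ε (δ.symm (δ b)) = δ b
        rw [show δ.symm (δ b) = b from δ.symm_apply_apply b, hδ]; exact e2
      · change ε (δ.symm (δ a)) = u
        rw [show δ.symm (δ a) = a from δ.symm_apply_apply a]; exact e1
    · rintro ⟨ε, e1, e2⟩
      exact ⟨δ.trans ε, e2, by rw [← hδ]; exact e1⟩
  rw [h1, h2, encard_stabOrbit_apply, encard_stabOrbit_apply, huni]

/-- The mass transport principle: a diagonally invariant mass transport sends out of a vertex as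
much mass as it sends into it. -/
theorem tsum_mass_transport {V : Type*} {G : SimpleGraph V} (htrans : IsTransitive G)
    (huni : IsUnimodular G) (F : V → V → ENNReal)
    (hF : ∀ (γ : G ≃g G) x y, F (γ x) (γ y) = F x y) (v : V) :
    ∑' u, F u v = ∑' u, F v u := by
  let f : Quotient (pairOrbit G) → ENNReal := Quotient.lift (fun a => F a.1 a.2) (by
    rintro a b ⟨γ, h1, h2⟩
    rw [← h1, ← h2, hF])
  have key : ∀ g : V → Quotient (pairOrbit G),
      ∑' u, f (g u) = ∑' Q, ({u | g u = Q}.encard : ENNReal) * f Q := by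
    intro g
    rw [← (Equiv.sigmaFiberEquiv g).tsum_eq, ENNReal.tsum_sigma']
    refine tsum_congr fun Q => ?_
    rw [← ENNReal.tsum_set_const]
    exact tsum_congr fun u => congrArg f u.2
  have h1 := key fun u => Quotient.mk _ (u, v)
  have h2 := key fun u => Quotient.mk _ (v, u)
  simp_rw [← encard_pairOrbit_fibre htrans huni v] at h1
  exact h1.trans h2.symm

/-! ### Paths -/

theorem exists_mem_Ico_of_tendsto_atTop {t : ℕ → ℝ≥0} (h0 : t 0 = 0) (ht : Tendsto t atTop atTop)
    (s : ℝ≥0) : ∃ i, s ∈ Set.Ico (t i) (t (i + 1)) := by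
  classical
  have hex : ∃ j, s < t j := (ht.eventually_gt_atTop s).exists
  have hpos : Nat.find hex ≠ 0 := by
    intro h
    have := Nat.find_spec hex
    rw [h, h0] at this
    exact not_lt_zero this
  obtain ⟨i, hi⟩ := Nat.exists_eq_succ_of_ne_zero hpos
  exact ⟨i, not_lt.1 (Nat.find_min hex (by omega)), by
    have := Nat.find_spec hex
    rwa [hi] at this⟩

theorem IsPath.exists_const_right {V : Type*} {G : SimpleGraph V} {y : ℝ≥0 → V}
    (hy : IsPath G y) (s : ℝ≥0) : ∃ s' > s, ∀ r ∈ Set.Ico s s', y r = y s := by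
  obtain ⟨t, v, h0, -, ht, hc, -⟩ := hy
  obtain ⟨i, hi⟩ := exists_mem_Ico_of_tendsto_atTop h0 ht s
  exact ⟨t (i + 1), hi.2, fun r hr => by rw [hc i r ⟨hi.1.trans hr.1, hr.2⟩, hc i s hi]⟩

theorem IsPath.finite_image_Iic {V : Type*} {G : SimpleGraph V} {y : ℝ≥0 → V}
    (hy : IsPath G y) (K : ℝ≥0) : (y '' Set.Iic K).Finite := by
  obtain ⟨t, v, h0, hm, ht, hc, -⟩ := hy
  obtain ⟨j, hj⟩ := (ht.eventually_gt_atTop K).exists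
  refine ((Set.finite_Iio j).image v).subset ?_
  rintro _ ⟨s, hs, rfl⟩
  obtain ⟨i, hi⟩ := exists_mem_Ico_of_tendsto_atTop h0 ht s
  exact ⟨i, hm.lt_iff_lt.1 ((hi.1.trans hs).trans_lt hj), (hc i s hi).symm⟩

open Classical in
/-- The vertices that a path visits at the first `m + 1` times of a fixed dense sequence. As a path
is right-continuous, these finite sets increase to the range of the path. -/
def visited {V : Type*} {G : SimpleGraph V} (y : Path G) (m : ℕ) : Finset V :=
  (Finset.range (m + 1)).image fun k => y.1 (TopologicalSpace.denseSeq ℝ≥0 k)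

theorem visited_nonempty {V : Type*} {G : SimpleGraph V} (y : Path G) (m : ℕ) :
    (visited y m).Nonempty := by
  classical
  exact Finset.Nonempty.image (by simp) _

theorem visited_mono {V : Type*} {G : SimpleGraph V} (y : Path G) : Monotone (visited y) := by
  classical
  intro m n h
  exact Finset.image_subset_image (Finset.range_mono (by omega))

theorem mem_range_of_mem_visited {V : Type*} {G : SimpleGraph V} {y : Path G} {m : ℕ} {v : V}
    (h : v ∈ visited y m) : v ∈ Set.range y.1 := by
  classical
  obtain ⟨k, -, rfl⟩ := Finset.mem_image.1 h
  exact ⟨_, rfl⟩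

theorem exists_mem_visited {V : Type*} {G : SimpleGraph V} {y : Path G} {v : V}
    (h : v ∈ Set.range y.1) : ∃ m, v ∈ visited y m := by
  classical
  obtain ⟨s, rfl⟩ := h
  obtain ⟨s', hs, hc⟩ := y.2.exists_const_right s
  obtain ⟨k, hk⟩ := (TopologicalSpace.denseRange_denseSeq ℝ≥0).exists_mem_open isOpen_Ioo
    (Set.nonempty_Ioo.2 hs)
  exact ⟨k, Finset.mem_image.2 ⟨k, by simp, hc _ ⟨hk.1.le, hk.2⟩⟩⟩

theorem tendsto_card_visited {V : Type*} {G : SimpleGraph V} {y : Path G}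
    (hy : (Set.range y.1).Infinite) : Tendsto (fun m => (visited y m).card) atTop atTop := by
  classical
  refine tendsto_atTop_atTop_of_monotone
    (fun m n h => Finset.card_le_card (visited_mono y h)) fun b => ?_
  obtain ⟨s, hs, rfl⟩ := hy.exists_subset_card_eq b
  have : ∀ v : V, ∃ m, v ∈ s → v ∈ visited y m := fun v => by
    by_cases hv : v ∈ s
    · exact (exists_mem_visited (hs hv)).imp fun m hm _ => hm
    · exact ⟨0, fun h => absurd h hv⟩
  choose m hm using this
  exact ⟨s.sup m, Finset.card_le_card fun v hv =>
    visited_mono y (Finset.le_sup (f := m) hv) (hm v hv)⟩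

theorem visited_map {V : Type*} {G : SimpleGraph V} (γ : G ≃g G) (y : Path G) (m : ℕ) :
    visited (y.map γ) m = (visited y m).map γ.toEquiv.toEmbedding := by
  classical
  ext v
  simp only [visited, Finset.mem_image, Finset.mem_map, Path.map]
  constructor
  · rintro ⟨k, hk, rfl⟩
    exact ⟨_, ⟨k, hk, rfl⟩, rfl⟩
  · rintro ⟨_, ⟨k, hk, rfl⟩, rfl⟩
    exact ⟨k, hk, rfl⟩

/-- The mass sent to `v` when a unit mass is spread uniformly over the vertices visited by the path
`y` at the first `m + 1` times of the dense sequence. -/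
def visitMass {V : Type*} {G : SimpleGraph V} (m : ℕ) (y : Path G) (v : V) : ENNReal :=
  (visited y m : Set V).indicator (fun _ => ((visited y m).card : ENNReal)⁻¹) v

theorem visitMass_le {V : Type*} {G : SimpleGraph V} (m : ℕ) (y : Path G) (v : V) :
    visitMass m y v ≤ ((visited y m).card : ENNReal)⁻¹ :=
  Set.indicator_le_self' (fun _ _ => zero_le) v

theorem visitMass_le_one {V : Type*} {G : SimpleGraph V} (m : ℕ) (y : Path G) (v : V) :
    visitMass m y v ≤ 1 := by
  refine (visitMass_le m y v).trans (ENNReal.inv_le_one.2 ?_)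
  exact_mod_cast (visited_nonempty y m).card_pos

theorem visitMass_eq_zero {V : Type*} {G : SimpleGraph V} (m : ℕ) {y : Path G} {v : V}
    (h : v ∉ Set.range y.1) : visitMass m y v = 0 :=
  Set.indicator_of_notMem (fun h' => h (mem_range_of_mem_visited h')) _

theorem tsum_visitMass {V : Type*} {G : SimpleGraph V} (m : ℕ) (y : Path G) :
    ∑' v, visitMass m y v = 1 := by
  have h : ∀ v ∉ visited y m, visitMass m y v = 0 := fun v hv =>
    Set.indicator_of_notMem (by simpa using hv) _
  have h' : ∀ v ∈ visited y m, visitMass m y v = ((visited y m).card : ENNReal)⁻¹ := fun v hv =>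
    Set.indicator_of_mem (by simpa using hv) _
  rw [tsum_eq_sum h, Finset.sum_congr rfl h', Finset.sum_const, nsmul_eq_mul]
  refine ENNReal.mul_inv_cancel ?_ (ENNReal.natCast_ne_top _)
  exact_mod_cast (visited_nonempty y m).card_pos.ne'

theorem visitMass_map {V : Type*} {G : SimpleGraph V} (γ : G ≃g G) (m : ℕ) (y : Path G) (v : V) :
    visitMass m (y.map γ) (γ v) = visitMass m y v := by
  classical
  have : γ v ∈ visited (y.map γ) m ↔ v ∈ visited y m := by
    rw [visited_map]
    exact Finset.mem_map' γ.toEquiv.toEmbedding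
  have hc : (visited (y.map γ) m).card = (visited y m).card := by rw [visited_map, Finset.card_map]
  simp only [visitMass, Set.indicator_apply, Finset.mem_coe, this, hc]

theorem tendsto_visitMass {V : Type*} {G : SimpleGraph V} {y : Path G}
    (hy : (Set.range y.1).Infinite) (v : V) :
    Tendsto (fun m => visitMass m y v) atTop (nhds 0) :=
  tendsto_of_tendsto_of_tendsto_of_le_of_le tendsto_const_nhds
    (ENNReal.tendsto_inv_nat_nhds_zero.comp (tendsto_card_visited hy)) (fun _ => zero_le)
    fun m => visitMass_le m y v

theorem measurable_path_eval {V : Type*} {G : SimpleGraph V} (t : ℝ≥0) :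
    Measurable[_, ⊤] fun y : Path G => y.1 t :=
  let _ : MeasurableSpace V := ⊤
  (measurable_pi_apply t).comp (comap_measurable (fun y : Path G => y.1))

theorem measurable_visitMass {V : Type*} [Countable V] {G : SimpleGraph V} (m : ℕ) (v : V) :
    Measurable fun y : Path G => visitMass m y v := by
  classical
  let _ : MeasurableSpace V := ⊤
  let S : (Fin (m + 1) → V) → Finset V := fun x => Finset.univ.image x
  have hS : ∀ y : Path G, visited y m = S fun k => y.1 (TopologicalSpace.denseSeq ℝ≥0 k) := by
    intro y
    ext w
    simp only [visited, S, Finset.mem_image, Finset.mem_range, Finset.mem_univ, true_and]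
    constructor
    · rintro ⟨k, hk, rfl⟩
      exact ⟨⟨k, hk⟩, rfl⟩
    · rintro ⟨k, rfl⟩
      exact ⟨k, k.2, rfl⟩
  have h : (fun y : Path G => visitMass m y v) =
      (fun x => (S x : Set V).indicator (fun _ => ((S x).card : ENNReal)⁻¹) v) ∘
        fun (y : Path G) (k : Fin (m + 1)) => y.1 (TopologicalSpace.denseSeq ℝ≥0 k) := by
    funext y
    simp only [visitMass, hS, Function.comp]
  rw [h]
  exact (measurable_of_countable _).comp
    (measurable_pi_lambda _ fun k => measurable_path_eval (TopologicalSpace.denseSeq ℝ≥0 k))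

/-! ### Solutions of the dynamics -/

namespace Model

variable {V : Type*} {G : SimpleGraph V} {M : Model G} {ω : Sample G} {τ : Clocks V} {p : Label V}

theorem IsSolution.clock_zero (h : M.IsSolution ω τ) (hp : Present ω p) : τ p 0 = 0 := by
  have := (h.1 p hp 0).2
  simpa using this

theorem IsSolution.clock_sub (h : M.IsSolution ω τ) (hp : Present ω p) (s t : ℝ≥0) :
    (τ p t : ℝ) - τ p s = ∫ r in (s : ℝ)..t, (M.rate ω τ p r.toNNReal : ℝ) := by
  rw [(h.1 p hp t).2, (h.1 p hp s).2,
    intervalIntegral.integral_interval_sub_left (h.1 p hp t).1 (h.1 p hp s).1]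

theorem IsSolution.monotone (h : M.IsSolution ω τ) (hp : Present ω p) : Monotone (τ p) := by
  intro s t hst
  rw [← NNReal.coe_le_coe, ← sub_nonneg, h.clock_sub hp]
  exact intervalIntegral.integral_nonneg (by exact_mod_cast hst) fun _ _ => NNReal.coe_nonneg _

theorem IsSolution.exists_clock_eq (h : M.IsSolution ω τ) (hp : Present ω p) {s t c : ℝ≥0}
    (hst : s ≤ t) (hs : τ p s ≤ c) (ht : c ≤ τ p t) : ∃ r ∈ Set.Icc s t, τ p r = c := by
  let f : ℝ → ℝ := fun b => ∫ r in (0 : ℝ)..b, (M.rate ω τ p r.toNNReal : ℝ)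
  have hf : ∀ r : ℝ≥0, f r = τ p r := fun r => ((h.1 p hp r).2).symm
  have hcont : ContinuousOn f (Set.Icc s t) := by
    have h1 := intervalIntegral.continuousOn_primitive_interval' (h.1 p hp t).1
      (Set.left_mem_uIcc)
    refine h1.mono ?_
    rw [Set.uIcc_of_le (NNReal.coe_nonneg t)]
    exact Set.Icc_subset_Icc_left (NNReal.coe_nonneg s)
  obtain ⟨r, hr, hrc⟩ := intermediate_value_Icc (show (s : ℝ) ≤ t by exact_mod_cast hst) hcont
    (show (c : ℝ) ∈ Set.Icc (f s) (f t) by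
      rw [hf, hf]; exact ⟨by exact_mod_cast hs, by exact_mod_cast ht⟩)
  lift r to ℝ≥0 using s.2.trans hr.1
  rw [hf] at hrc
  exact ⟨r, ⟨by exact_mod_cast hr.1, by exact_mod_cast hr.2⟩, by exact_mod_cast hrc⟩

/-- A particle whose inner clock is unbounded must leave `v` whenever it is there, so it cannot be
there after the fixation of `v`; hence, if `v` is on its putative path, it visits `v` before. -/
theorem IsSolution.exists_pos_eq_of_vertexFixatesAt (h : M.IsSolution ω τ) (hp : Present ω p)
    (hunb : ∀ n : ℕ, ∃ k : ℕ, (n : ℝ≥0) ≤ τ p k) {v : V} {T : ℝ≥0}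
    (hT : M.VertexFixatesAt ω τ v T) (hv : v ∈ Set.range ((ω p.1).2 p.2).1.1) :
    ∃ s ≤ T, pos ω τ p s = v := by
  have hreach : ∀ s c : ℝ≥0, τ p s ≤ c → ∃ r ≥ s, τ p r = c := by
    intro s c hsc
    obtain ⟨n, hn⟩ := exists_nat_ge c
    obtain ⟨k, hk⟩ := hunb n
    obtain ⟨r, hr, hrc⟩ := h.exists_clock_eq hp (le_max_left s k) hsc
      ((hn.trans hk).trans (h.monotone hp (le_max_right s (k : ℝ≥0))))
    exact ⟨r, hr.1, hrc⟩
  obtain ⟨c, hc⟩ := hv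
  obtain ⟨s, -, hs⟩ := hreach 0 c (by rw [h.clock_zero hp]; exact zero_le)
  rcases le_or_gt s T with hsT | hsT
  · exact ⟨s, hsT, by rw [pos, hs, hc]⟩
  exfalso
  obtain ⟨c', hcc', hconst⟩ := ((ω p.1).2 p.2).1.2.exists_const_right c
  obtain ⟨d, hcd, hdc'⟩ := exists_between hcc'
  obtain ⟨r, hsr, hr⟩ := hreach s d (hs.le.trans hcd.le)
  -- Between the times `s` and `r` the particle stays at `v`, which has fixated.
  have hrate : ∀ x ∈ Set.Icc s r, M.rate ω τ p x = 0 := by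
    intro x hx
    have hpos : pos ω τ p x = v := by
      rw [pos, hconst _ ⟨?_, ?_⟩, hc]
      · rw [← hs]; exact h.monotone hp hx.1
      · exact ((h.monotone hp hx.2).trans hr.le).trans_lt hdc'
    have := hT.1 x (hsT.trans_le hx.1) p hpos
    simpa [Active, hp] using this
  have hzero : (τ p r : ℝ) - τ p s = 0 := by
    rw [h.clock_sub hp]
    refine intervalIntegral.integral_zero_ae (ae_of_all _ fun x hx => ?_)
    rw [Set.uIoc_of_le (by exact_mod_cast hsr)] at hx
    rw [hrate _ ⟨NNReal.le_toNNReal_of_coe_le hx.1.le, Real.toNNReal_le_iff_le_coe.2 hx.2⟩]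
    rfl
  rw [hs, hr, sub_eq_zero] at hzero
  exact hcd.ne' (by exact_mod_cast hzero)

theorem exists_particleFixatesAt {T : ℝ≥0} (hT : ∀ s > T, ¬ M.Active ω τ p s) :
    ∃ t, M.ParticleFixatesAt ω τ p t := by
  have hne : {t : ℝ≥0 | ∀ s > t, ¬ M.Active ω τ p s}.Nonempty := ⟨T, hT⟩
  refine ⟨sInf {t : ℝ≥0 | ∀ s > t, ¬ M.Active ω τ p s}, ?_, fun t ht => csInf_le' ht⟩
  intro s hs
  obtain ⟨t, ht, hts⟩ := exists_lt_of_csInf_lt hne hs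
  exact ht s hts

/-- A particle with a bounded inner clock visits only finitely many vertices, so that it is not
active after all of these have fixated. -/
theorem IsSolution.exists_particleFixatesAt (h : M.IsSolution ω τ) (hp : Present ω p)
    (hb : ¬ ∀ n : ℕ, ∃ k : ℕ, (n : ℝ≥0) ≤ τ p k)
    (hfix : ∀ v, ∃ t, M.VertexFixatesAt ω τ v t) : ∃ t, M.ParticleFixatesAt ω τ p t := by
  push Not at hb
  obtain ⟨n, hn⟩ := hb
  choose T hT using hfix
  have hfin := ((ω p.1).2 p.2).1.2.finite_image_Iic (n : ℝ≥0)
  obtain ⟨B, hB⟩ := (hfin.image T).bddAbove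
  refine Model.exists_particleFixatesAt (T := B) fun s hs => ?_
  obtain ⟨k, hk⟩ := exists_nat_ge s
  refine (hT (pos ω τ p s)).1 s (lt_of_le_of_lt (hB ⟨_, ⟨τ p s, ?_, rfl⟩, rfl⟩) hs) p rfl
  exact (h.monotone hp hk).trans (hn k).le

end Model

/-! ### Automorphism invariance of the law and of the clocks -/

/-- The image of the randomness at a vertex under an automorphism. -/
def seedMap {V : Type*} {G : SimpleGraph V} (γ : G ≃g G) (s : Seed G) : Seed G :=
  (s.1, fun i => ((s.2 i).1.map γ, (s.2 i).2))

/-- The action of an automorphism on the sample space: it moves the randomness at `v` to `γ v`. -/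
def sampleMap {V : Type*} {G : SimpleGraph V} (γ : G ≃g G) (ω : Sample G) : Sample G :=
  fun v => seedMap γ (ω (γ.symm v))

theorem sampleMap_apply {V : Type*} {G : SimpleGraph V} (γ : G ≃g G) (ω : Sample G) (v : V) :
    sampleMap γ ω (γ v) = seedMap γ (ω v) := by
  rw [sampleMap, show γ.symm (γ v) = v from γ.symm_apply_apply v]

theorem measurable_pathMap {V : Type*} {G : SimpleGraph V} (γ : G ≃g G) :
    Measurable (Path.map γ : Path G → Path G) := by
  let _ : MeasurableSpace V := ⊤
  refine measurable_comap_iff.2 (measurable_pi_lambda _ fun t => ?_)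
  exact measurable_from_top.comp (measurable_path_eval t)

theorem measurable_seedMap {V : Type*} {G : SimpleGraph V} (γ : G ≃g G) :
    Measurable (seedMap γ) := by
  have := measurable_pathMap γ
  unfold seedMap
  fun_prop

theorem measurable_sampleMap {V : Type*} {G : SimpleGraph V} (γ : G ≃g G) :
    Measurable (sampleMap γ) :=
  measurable_pi_lambda _ fun _ => (measurable_seedMap γ).comp (measurable_pi_apply _)

namespace Model

variable {V : Type*} {G : SimpleGraph V} {M : Model G}

variable (M) in
/-- The law of the randomness attached to the vertex `v`. -/
def seedLaw (v : V) : Measure (Seed G) :=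
  M.μ.prod (Measure.infinitePi fun _ : ℕ => (M.ν v).prod (volume : Measure I))

instance (v : V) : IsProbabilityMeasure (M.seedLaw v) := by
  unfold seedLaw; infer_instance

instance : IsProbabilityMeasure M.law := by
  unfold law; infer_instance

theorem law_eq : M.law = Measure.infinitePi M.seedLaw := rfl

theorem map_seedLaw (hpath : M.PathInvariant) (γ : G ≃g G) (v : V) :
    (M.seedLaw v).map (seedMap γ) = M.seedLaw (γ v) := by
  have hγ := measurable_pathMap γ
  have hg : Measurable (Prod.map (Path.map γ) id : Path G × I → Path G × I) :=
    hγ.prodMap measurable_id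
  have h1 : ((M.ν v).prod (volume : Measure I)).map (Prod.map (Path.map γ) id)
      = (M.ν (γ v)).prod volume := by
    rw [← Measure.map_prod_map _ _ hγ measurable_id, hpath, Measure.map_id]
  have h2 := Measure.infinitePi_map_pi (fun _ : ℕ => (M.ν v).prod (volume : Measure I))
    (fun _ => hg)
  rw [h1] at h2
  have h3 : (seedMap γ : Seed G → Seed G)
      = Prod.map id fun x i => Prod.map (Path.map γ) id (x i) := rfl
  rw [h3, seedLaw, ← Measure.map_prod_map _ _ measurable_id (by fun_prop), h2, Measure.map_id]
  rfl

theorem measurePreserving_sampleMap (hpath : M.PathInvariant) (γ : G ≃g G) :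
    MeasurePreserving (sampleMap γ) M.law M.law := by
  classical
  refine ⟨measurable_sampleMap γ, ?_⟩
  rw [law_eq]
  refine Measure.eq_infinitePi _ fun s t ht => ?_
  have hpre : sampleMap γ ⁻¹' (Set.pi s t) =
      Set.pi (s.map γ.symm.toEquiv.toEmbedding : Finset V) fun u => seedMap γ ⁻¹' t (γ u) := by
    ext ω
    simp only [Set.mem_preimage, Set.mem_pi, Finset.coe_map, Set.forall_mem_image]
    refine forall₂_congr fun v _ => ?_
    change _ ↔ seedMap γ (ω (γ.symm v)) ∈ t (γ (γ.symm v))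
    rw [show γ (γ.symm v) = v from γ.apply_symm_apply v]
    rfl
  rw [Measure.map_apply (measurable_sampleMap γ)
    (MeasurableSet.pi s.countable_toSet fun v _ => ht v), hpre,
    Measure.infinitePi_pi _ fun u _ => measurable_seedMap γ (ht _), Finset.prod_map]
  refine Finset.prod_congr rfl fun v _ => ?_
  rw [← Measure.map_apply (measurable_seedMap γ) (ht _), map_seedLaw hpath]
  change M.seedLaw (γ (γ.symm v)) (t (γ (γ.symm v))) = _
  rw [show γ (γ.symm v) = v from γ.apply_symm_apply v]

/-- The image of a family of clocks under an automorphism. -/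
def clocksMap (γ : G ≃g G) (τ : Clocks V) : Clocks V := fun p => τ (γ.symm p.1, p.2)

theorem clocksMap_apply (γ : G ≃g G) (τ : Clocks V) (p : Label V) :
    clocksMap γ τ (γ p.1, p.2) = τ p := by
  simp only [clocksMap, show γ.symm (γ p.1) = p.1 from γ.symm_apply_apply p.1]

theorem pos_sampleMap (γ : G ≃g G) (ω : Sample G) (τ : Clocks V) (p : Label V) (t : ℝ≥0) :
    pos (sampleMap γ ω) (clocksMap γ τ) p t = γ (pos ω τ (γ.symm p.1, p.2) t) := rfl

theorem history_sampleMap (γ : G ≃g G) (ω : Sample G) (τ : Clocks V) (t : ℝ≥0) :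
    history (sampleMap γ ω) (clocksMap γ τ) t = (history ω τ t).map γ := by
  funext q
  by_cases h : Present ω (γ.symm q.1, q.2)
  · have h' : Present (sampleMap γ ω) q := h
    simp only [history, History.map, if_pos h, if_pos h', Option.map_some]
    rfl
  · have h' : ¬ Present (sampleMap γ ω) q := h
    simp only [history, History.map, if_neg h, if_neg h', Option.map_none]

theorem rate_sampleMap (hrule : M.rule.IsInvariant G) (γ : G ≃g G) (ω : Sample G) (τ : Clocks V)
    (p : Label V) (t : ℝ≥0) :
    M.rate (sampleMap γ ω) (clocksMap γ τ) p t = M.rate ω τ (γ.symm p.1, p.2) t := by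
  rw [rate, rate, history_sampleMap, ← hrule γ (γ.symm p.1, p.2)]
  exact congrArg (fun q => M.rule q t _) (Prod.ext (γ.apply_symm_apply p.1).symm rfl)

theorem IsSolution.sampleMap (hrule : M.rule.IsInvariant G) (γ : G ≃g G) {ω : Sample G}
    {τ : Clocks V} (h : M.IsSolution ω τ) : M.IsSolution (sampleMap γ ω) (clocksMap γ τ) := by
  refine ⟨fun p hp t => ?_, fun p hp t => h.2 (γ.symm p.1, p.2) hp t⟩
  simp only [rate_sampleMap hrule]
  exact h.1 (γ.symm p.1, p.2) hp t

theorem locallyFiniteVisits_sampleMap (γ : G ≃g G) {ω : Sample G} {τ : Clocks V}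
    (h : LocallyFiniteVisits ω τ) : LocallyFiniteVisits (sampleMap γ ω) (clocksMap γ τ) := by
  intro v t
  refine ((h (γ.symm v) t).image fun p => (γ p.1, p.2)).subset ?_
  rintro p ⟨hp, s, hs, hv⟩
  refine ⟨(γ.symm p.1, p.2), ⟨hp, s, hs, ?_⟩, ?_⟩
  · rw [← hv, pos_sampleMap]
    exact (γ.symm_apply_apply _).symm
  · exact Prod.ext (γ.apply_symm_apply p.1) rfl

/-- By uniqueness of the solution, the clocks are almost surely automorphism equivariant. -/
theorem IsRealization.ae_sampleMap (hpath : M.PathInvariant) (hrule : M.rule.IsInvariant G)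
    {τ : Sample G → Clocks V} (hτ : M.IsRealization τ) (γ : G ≃g G) :
    ∀ᵐ ω ∂M.law, τ (sampleMap γ ω) = clocksMap γ (τ ω) := by
  filter_upwards [hτ.solution, hτ.locallyFinite,
    (measurePreserving_sampleMap hpath γ).quasiMeasurePreserving.ae hτ.unique] with ω h1 h2 h3
  exact (h3 _ (h1.sampleMap hrule γ) (locallyFiniteVisits_sampleMap γ h2)).symm

end Model

/-! ### Two facts about nonnegative random variables -/

theorem lintegral_tsum_sq_le_two {ι Ω : Type*} [Countable ι] [MeasurableSpace Ω] {P : Measure Ω}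
    {f : ι → Ω → ENNReal} (hf : ∀ u, Measurable (f u))
    (hind : Pairwise fun u w => ProbabilityTheory.IndepFun (f u) (f w) P)
    (h1 : ∀ u ω, f u ω ≤ 1) (hsum : ∑' u, ∫⁻ ω, f u ω ∂P = 1) :
    ∫⁻ ω, (∑' u, f u ω) ^ 2 ∂P ≤ 2 := by
  classical
  have hpair : ∀ u w, ∫⁻ ω, f u ω * f w ω ∂P ≤
      (∫⁻ ω, f u ω ∂P) * (∫⁻ ω, f w ω ∂P) + if w = u then ∫⁻ ω, f u ω ∂P else 0 := by
    intro u w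
    by_cases h : w = u
    · subst h
      -- On the diagonal, a variable with values in `[0, 1]` dominates its square.
      rw [if_pos rfl]
      refine le_add_of_nonneg_of_le zero_le (lintegral_mono fun ω => ?_)
      exact mul_le_of_le_one_right zero_le (h1 w ω)
    · rw [if_neg h, add_zero]
      exact (ProbabilityTheory.lintegral_mul_eq_lintegral_mul_lintegral_of_indepFun (hf u) (hf w)
        (hind (Ne.symm h))).le
  calc ∫⁻ ω, (∑' u, f u ω) ^ 2 ∂P = ∫⁻ ω, ∑' u, ∑' w, f u ω * f w ω ∂P := by
        simp_rw [sq, ENNReal.tsum_mul_left, ENNReal.tsum_mul_right]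
    _ = ∑' u, ∑' w, ∫⁻ ω, f u ω * f w ω ∂P := by
        have hm : ∀ u, Measurable fun ω => ∑' w, f u ω * f w ω := fun u =>
          Measurable.tsum fun w => (hf u).mul (hf w)
        rw [lintegral_tsum fun u => (hm u).aemeasurable]
        exact tsum_congr fun u => lintegral_tsum fun w => ((hf u).mul (hf w)).aemeasurable
    _ ≤ ∑' u, ∑' w, ((∫⁻ ω, f u ω ∂P) * (∫⁻ ω, f w ω ∂P)
          + if w = u then ∫⁻ ω, f u ω ∂P else 0) :=
        ENNReal.tsum_le_tsum fun u => ENNReal.tsum_le_tsum fun w => hpair u w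
    _ = 2 := by
        simp_rw [ENNReal.tsum_add, ENNReal.tsum_mul_left, hsum, mul_one, tsum_ite_eq, hsum]
        norm_num

/-- Random variables with bounded second moments are uniformly integrable. -/
theorem tendsto_lintegral_zero_of_sq_le {Ω : Type*} [MeasurableSpace Ω] {P : Measure Ω}
    [IsProbabilityMeasure P] {W : ℕ → Ω → ENNReal} (hW : ∀ m, AEMeasurable (W m) P)
    {C : ENNReal} (hC : C ≠ ⊤) (hsq : ∀ m, ∫⁻ ω, W m ω ^ 2 ∂P ≤ C)
    (hlim : ∀ᵐ ω ∂P, Tendsto (fun m => W m ω) atTop (nhds 0)) :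
    Tendsto (fun m => ∫⁻ ω, W m ω ∂P) atTop (nhds 0) := by
  -- Truncate at the level `K + 1`, using `w ≤ min w c + w ^ 2 / c`.
  have hbound : ∀ (K : ℕ) (m : ℕ), ∫⁻ ω, W m ω ∂P ≤
      ∫⁻ ω, min (W m ω) (K + 1 : ℕ) ∂P + C * ((K + 1 : ℕ) : ENNReal)⁻¹ := by
    intro K m
    calc ∫⁻ ω, W m ω ∂P
        ≤ ∫⁻ ω, (min (W m ω) (K + 1 : ℕ) + W m ω ^ 2 * ((K + 1 : ℕ) : ENNReal)⁻¹) ∂P := by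
          refine lintegral_mono fun ω => ?_
          rcases le_total (W m ω) (K + 1 : ℕ) with h | h
          · rw [min_eq_left h]
            exact le_self_add
          · refine le_add_of_nonneg_of_le zero_le ?_
            rw [← div_eq_mul_inv, ENNReal.le_div_iff_mul_le (Or.inl (by positivity))
              (Or.inl (ENNReal.natCast_ne_top _)), sq]
            gcongr
      _ = ∫⁻ ω, min (W m ω) (K + 1 : ℕ) ∂P
            + (∫⁻ ω, W m ω ^ 2 ∂P) * ((K + 1 : ℕ) : ENNReal)⁻¹ := by
          rw [lintegral_add_left' ((hW m).min aemeasurable_const),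
            lintegral_mul_const'' _ ((hW m).pow_const 2)]
      _ ≤ _ := by gcongr; exact hsq m
  have htrunc : ∀ K : ℕ, Tendsto (fun m => ∫⁻ ω, min (W m ω) (K + 1 : ℕ) ∂P) atTop (nhds 0) := by
    intro K
    have := tendsto_lintegral_of_dominated_convergence' (μ := P) (f := fun _ => 0)
      (F := fun m ω => min (W m ω) (K + 1 : ℕ)) (fun _ => ((K + 1 : ℕ) : ENNReal))
      (fun m => (hW m).min aemeasurable_const)
      (fun m => ae_of_all _ fun ω => min_le_right _ _)
      (by simp)
      (by
        filter_upwards [hlim] with ω hω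
        exact tendsto_of_tendsto_of_tendsto_of_le_of_le tendsto_const_nhds hω (fun _ => zero_le)
          fun _ => min_le_left _ _)
    simpa using this
  have hsup : limsup (fun m => ∫⁻ ω, W m ω ∂P) atTop = 0 := by
    have hK : ∀ K : ℕ, limsup (fun m => ∫⁻ ω, W m ω ∂P) atTop
        ≤ C * ((K + 1 : ℕ) : ENNReal)⁻¹ := fun K => by
      have h1 := (htrunc K).add_const (C * ((K + 1 : ℕ) : ENNReal)⁻¹)
      rw [zero_add] at h1
      exact (limsup_le_limsup (Eventually.of_forall (hbound K))).trans h1.limsup_eq.le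
    have h2 : Tendsto (fun K : ℕ => C * ((K + 1 : ℕ) : ENNReal)⁻¹) atTop (nhds 0) := by
      have := ENNReal.Tendsto.const_mul (a := C)
        (ENNReal.tendsto_inv_nat_nhds_zero.comp (tendsto_add_atTop_nat 1)) (Or.inr hC)
      simpa using this
    exact le_antisymm (ge_of_tendsto' h2 hK) zero_le
  exact tendsto_of_le_liminf_of_limsup_le zero_le hsup.le

/-! ### Particles with unbounded inner clocks -/

namespace Model

variable {V : Type*} {G : SimpleGraph V} {M : Model G}

theorem measurable_path (u : V) (i : ℕ) : Measurable fun ω : Sample G => ((ω u).2 i).1 := by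
  fun_prop

theorem map_path_law (u : V) (i : ℕ) :
    M.law.map (fun ω : Sample G => ((ω u).2 i).1) = M.ν u := by
  have h1 : MeasurePreserving (fun ω : Sample G => ω u) M.law (M.seedLaw u) :=
    measurePreserving_eval_infinitePi _ u
  have h2 : MeasurePreserving (Prod.snd : Seed G → ℕ → Path G × I) (M.seedLaw u) _ :=
    measurePreserving_snd
  have h3 := measurePreserving_eval_infinitePi
    (fun _ : ℕ => (M.ν u).prod (volume : Measure I)) i
  have h4 : MeasurePreserving (Prod.fst : Path G × I → Path G)
    ((M.ν u).prod (volume : Measure I)) (M.ν u) := measurePreserving_fst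
  exact (h4.comp (h3.comp (h2.comp h1))).map_eq

/-- The expected mass received at `v`, if each particle `(u, i)` in an equivariant random set
spreads a unit mass over the vertices visited by its putative path, is the probability that `(v, i)`
is in the set. -/
theorem lintegral_tsum_indicator_visitMass [Countable V] (htrans : IsTransitive G)
    (huni : IsUnimodular G) (hpath : M.PathInvariant) {A : V → Set (Sample G)}
    (hA : ∀ u, NullMeasurableSet (A u) M.law)
    (hequi : ∀ (γ : G ≃g G) u, ∀ᵐ ω ∂M.law, (sampleMap γ ω ∈ A (γ u) ↔ ω ∈ A u))
    (i m : ℕ) (v : V) :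
    ∫⁻ ω, ∑' u, (A u).indicator (fun ω => visitMass m ((ω u).2 i).1 v) ω ∂M.law
      = M.law (A v) := by
  classical
  have hmeas : ∀ u w, AEMeasurable
      ((A u).indicator (fun ω : Sample G => visitMass m ((ω u).2 i).1 w)) M.law := fun u w =>
    ((measurable_visitMass m w).comp (measurable_path u i)).aemeasurable.indicator₀ (hA u)
  let F : V → V → ENNReal := fun u w =>
    ∫⁻ ω, (A u).indicator (fun ω => visitMass m ((ω u).2 i).1 w) ω ∂M.law
  have hF : ∀ (γ : G ≃g G) u w, F (γ u) (γ w) = F u w := by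
    intro γ u w
    have hγ := measurePreserving_sampleMap hpath γ
    change ∫⁻ ω, _ ∂M.law = ∫⁻ ω, _ ∂M.law
    rw [← hγ.map_eq, lintegral_map' (by rw [hγ.map_eq]; exact hmeas _ _) hγ.measurable.aemeasurable,
      hγ.map_eq]
    refine lintegral_congr_ae ?_
    filter_upwards [hequi γ u] with ω hω
    simp only [Set.indicator_apply, hω, sampleMap_apply]
    rw [seedMap, visitMass_map]
  rw [lintegral_tsum fun u => hmeas u v]
  refine (tsum_mass_transport htrans huni F hF v).trans ?_
  rw [← lintegral_tsum fun u => hmeas v u]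
  have : ∀ ω, ∑' u, (A v).indicator (fun ω => visitMass m ((ω v).2 i).1 u) ω
      = (A v).indicator 1 ω := by
    intro ω
    by_cases h : ω ∈ A v
    · simp only [Set.indicator_of_mem h, tsum_visitMass, Pi.one_apply]
    · simp only [Set.indicator_of_notMem h, tsum_zero]
  simp_rw [this]
  exact lintegral_indicator_one₀ (hA v)

/-- By independence, the total mass that a vertex receives from all the putative paths has a bounded
second moment. -/
theorem lintegral_tsum_visitMass_sq_le [Countable V] (htrans : IsTransitive G)
    (huni : IsUnimodular G) (hpath : M.PathInvariant) (i m : ℕ) (v : V) :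
    ∫⁻ ω, (∑' u, visitMass m ((ω u).2 i).1 v) ^ 2 ∂M.law ≤ 2 := by
  have hmeas : ∀ u, Measurable fun ω : Sample G => visitMass m ((ω u).2 i).1 v := fun u =>
    (measurable_visitMass m v).comp (measurable_path u i)
  refine lintegral_tsum_sq_le_two hmeas (fun u w huw => ?_) (fun u ω => visitMass_le_one _ _ _) ?_
  · refine (ProbabilityTheory.iIndepFun_infinitePi (P := M.seedLaw)
      (X := fun (u : V) (s : Seed G) => visitMass m (s.2 i).1 v) fun u => ?_).indepFun huw
    exact (measurable_visitMass m v).comp (by fun_prop : Measurable fun s : Seed G => (s.2 i).1)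
  · rw [← lintegral_tsum fun u => (hmeas u).aemeasurable]
    have := lintegral_tsum_indicator_visitMass htrans huni hpath (A := fun _ => Set.univ)
      (fun _ => MeasurableSet.univ.nullMeasurableSet) (fun γ u => ae_of_all _ fun ω => by simp) i m v
    simpa using this

/-- The event that the inner clock of the particle `p` is unbounded. As clocks are monotone, it is
enough to look at integer times, which makes the event measurable without any regularity. -/
def UnboundedClock (τ : Sample G → Clocks V) (p : Label V) : Set (Sample G) :=
  {ω | ∀ n : ℕ, ∃ k : ℕ, (n : ℝ≥0) ≤ τ ω p k}

theorem IsRealization.nullMeasurableSet_unboundedClock {τ : Sample G → Clocks V}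
    (hτ : M.IsRealization τ) (p : Label V) : NullMeasurableSet (UnboundedClock τ p) M.law := by
  have : UnboundedClock τ p = ⋂ n : ℕ, ⋃ k : ℕ, (fun ω => τ ω p k) ⁻¹' Set.Ici (n : ℝ≥0) := by
    ext ω
    simp [UnboundedClock]
  rw [this]
  exact .iInter fun n => .iUnion fun k => (hτ.aemeasurable p k).nullMeasurableSet_preimage
    measurableSet_Ici

theorem IsRealization.sampleMap_mem_unboundedClock (hpath : M.PathInvariant)
    (hrule : M.rule.IsInvariant G) {τ : Sample G → Clocks V} (hτ : M.IsRealization τ)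
    (γ : G ≃g G) (p : Label V) :
    ∀ᵐ ω ∂M.law, (sampleMap γ ω ∈ UnboundedClock τ (γ p.1, p.2) ↔ ω ∈ UnboundedClock τ p) := by
  filter_upwards [hτ.ae_sampleMap hpath hrule γ] with ω hω
  change (∀ n : ℕ, ∃ k : ℕ, (n : ℝ≥0) ≤ τ (sampleMap γ ω) (γ p.1, p.2) k) ↔ _
  rw [hω, clocksMap_apply]
  rfl

theorem IsSolution.present_of_unbounded {ω : Sample G} {τ : Clocks V} (h : M.IsSolution ω τ)
    {p : Label V} (hunb : ∀ n : ℕ, ∃ k : ℕ, (n : ℝ≥0) ≤ τ p k) : Present ω p := by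
  by_contra hp
  obtain ⟨k, hk⟩ := hunb 1
  rw [h.2 p hp] at hk
  simp at hk

/-- If `v` fixates, only finitely many particles with unbounded clocks have `v` on their putative
path, and the mass that each of them sends to `v` vanishes as the mass is spread over more and more
vertices. -/
theorem tendsto_tsum_indicator_visitMass [Countable V] (hrange : M.InfiniteRange)
    {τ : Sample G → Clocks V} (hτ : M.IsRealization τ) (hfix : M.VertexFixating τ) (i : ℕ) (v : V) :
    ∀ᵐ ω ∂M.law, Tendsto (fun m => ∑' u, (UnboundedClock τ (u, i)).indicator
      (fun ω => visitMass m ((ω u).2 i).1 v) ω) atTop (nhds 0) := by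
  have hinf : ∀ᵐ ω ∂M.law, ∀ u, (Set.range ((ω u).2 i).1.1).Infinite := by
    rw [ae_all_iff]
    intro u
    have := hrange u
    rw [← map_path_law u i] at this
    exact ae_of_ae_map (measurable_path u i).aemeasurable this
  filter_upwards [hτ.solution, hτ.locallyFinite, hfix v, hinf] with ω hsol hloc ⟨T, hT⟩ hω
  have hS : {u | ω ∈ UnboundedClock τ (u, i) ∧ v ∈ Set.range ((ω u).2 i).1.1}.Finite := by
    refine ((hloc v T).preimage (f := fun u => (u, i)) fun a _ b _ h => congrArg Prod.fst h).subset
      ?_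
    rintro u ⟨hu, hv⟩
    have hp := hsol.present_of_unbounded hu
    exact ⟨hp, hsol.exists_pos_eq_of_vertexFixatesAt hp hu hT hv⟩
  have hsum : ∀ m, ∑' u, (UnboundedClock τ (u, i)).indicator
      (fun ω => visitMass m ((ω u).2 i).1 v) ω = ∑ u ∈ hS.toFinset,
        (UnboundedClock τ (u, i)).indicator (fun ω => visitMass m ((ω u).2 i).1 v) ω := by
    intro m
    refine tsum_eq_sum fun u hu => ?_
    rw [Set.Finite.mem_toFinset] at hu
    by_cases h : ω ∈ UnboundedClock τ (u, i)
    · rw [Set.indicator_of_mem h]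
      exact visitMass_eq_zero m fun hv => hu ⟨h, hv⟩
    · exact Set.indicator_of_notMem h _
  simp_rw [hsum]
  rw [← Finset.sum_const_zero (s := hS.toFinset)]
  refine tendsto_finsetSum _ fun u _ => ?_
  exact tendsto_of_tendsto_of_tendsto_of_le_of_le tendsto_const_nhds
    (tendsto_visitMass (hω u) v) (fun _ => zero_le) fun m =>
      Set.indicator_le_self' (fun _ _ => zero_le) ω

theorem IsRealization.law_unboundedClock [Countable V] (htrans : IsTransitive G)
    (huni : IsUnimodular G) (hpath : M.PathInvariant) (hrange : M.InfiniteRange)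
    (hrule : M.rule.IsInvariant G) {τ : Sample G → Clocks V} (hτ : M.IsRealization τ)
    (hfix : M.VertexFixating τ) (p : Label V) : M.law (UnboundedClock τ p) = 0 := by
  obtain ⟨v, i⟩ := p
  let W : ℕ → Sample G → ENNReal := fun m ω => ∑' u, (UnboundedClock τ (u, i)).indicator
    (fun ω => visitMass m ((ω u).2 i).1 v) ω
  have hmeas : ∀ m, AEMeasurable (W m) M.law := fun m => AEMeasurable.tsum fun u =>
    ((measurable_visitMass m v).comp (measurable_path u i)).aemeasurable.indicator₀
      (hτ.nullMeasurableSet_unboundedClock (u, i))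
  have hsq : ∀ m, ∫⁻ ω, W m ω ^ 2 ∂M.law ≤ 2 := fun m =>
    (lintegral_mono fun ω => pow_le_pow_left' (ENNReal.tsum_le_tsum fun u =>
      Set.indicator_le_self' (fun _ _ => zero_le) ω) 2).trans
      (lintegral_tsum_visitMass_sq_le htrans huni hpath i m v)
  have hlim := tendsto_lintegral_zero_of_sq_le hmeas (by simp) hsq
    (tendsto_tsum_indicator_visitMass hrange hτ hfix i v)
  have hW : ∀ m, ∫⁻ ω, W m ω ∂M.law = M.law (UnboundedClock τ (v, i)) := fun m =>
    lintegral_tsum_indicator_visitMass htrans huni hpath (A := fun u => UnboundedClock τ (u, i))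
      (fun u => hτ.nullMeasurableSet_unboundedClock (u, i))
      (fun γ u => hτ.sampleMap_mem_unboundedClock hpath hrule γ (u, i)) i m v
  simp_rw [hW] at hlim
  exact tendsto_nhds_unique tendsto_const_nhds hlim

end Model

end ParticleSystem

end

theorem theorem1 {V : Type*} [Infinite V] (G : SimpleGraph V) (hconn : G.Connected)
    (hfin : ∀ v, (G.neighborSet v).Finite) (htrans : ParticleSystem.IsTransitive G)
    (huni : ParticleSystem.IsUnimodular G) (M : ParticleSystem.Model G)
    (hpath : M.PathInvariant) (hrange : M.InfiniteRange)
    (hrule : M.rule.IsInvariant G) (hlocal : M.rule.IsLocal G)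
    (τ : ParticleSystem.Sample G → ParticleSystem.Clocks V) (hτ : M.IsRealization τ)
    (hfix : M.VertexFixating τ) : M.ParticleFixating τ := by
  have := ParticleSystem.countable_of_connected hconn hfin
  intro p
  filter_upwards [hτ.solution, ae_all_iff.2 hfix,
    measure_eq_zero_iff_ae_notMem.1
      (hτ.law_unboundedClock htrans huni hpath hrange hrule hfix p)] with ω hsol hω hp hpres
  exact hsol.exists_particleFixatesAt hpres hp hω
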